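/- Let $X$ be a Tychonoff space and let $C_p(X)$ be the space of continuous real-valued functions on $X$ with the topology of pointwise convergence. Suppose that $C_p(X)$ is $\kappa$-Fréchet–Urysohn, i.e. for every open $U\subseteq C_p(X)$ and every $g\in\overline{U}$ there is a sequence in $U$ converging to $g$. Then $X$ is $B_\pi$-scattered: for every nonempty Baire space $B$ with a countable $\pi$-base and every continuous map $f:B\to X$ there is a nonempty open set $U\subseteq B$ such that $f(U)$ is finite. (A $\pi$-base of $B$ is a family of nonempty open sets such that every nonempty open subset of $B$ contains a member of the family.) Hence $X$ is also $k$-scattered: every compact Hausdorff subspace $K$ of $X$ is scattered, i.e. every nonempty subspace of $K$ has an isolated point. Here "hence" means that every $B_\pi$-scattered Tychonoff space is $k$-scattered. -/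

import Mathlib

open Set Filter Topology

universe u v

/-- `C_p(X)`: the continuous real-valued functions on `X`, with the topology of pointwise
convergence, i.e. the subspace topology inherited from the product `X → ℝ`. -/
abbrev Cp (X : Type u) [TopologicalSpace X] : Type u :=
  {f : X → ℝ // Continuous f}

/-- A space is `κ`-Fréchet–Urysohn if every point of the closure of an open set `U` is the limit
of a sequence of points of `U`. -/
def IsKappaFrechetUrysohn (Y : Type u) [TopologicalSpace Y] : Prop :=
  ∀ U : Set Y, IsOpen U → ∀ y ∈ closure U,
    ∃ a : ℕ → Y, (∀ n, a n ∈ U) ∧ Tendsto a atTop (𝓝 y)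

/-- A `π`-base: a family of nonempty open sets such that every nonempty open set contains a
member of the family. -/
def IsPiBase {B : Type v} [TopologicalSpace B] (P : Set (Set B)) : Prop :=
  (∀ V ∈ P, IsOpen V ∧ V.Nonempty) ∧
    ∀ U : Set B, IsOpen U → U.Nonempty → ∃ V ∈ P, V ⊆ U

/-- `X` is `B_π`-scattered: for every (nonempty) Baire space `B` with a countable `π`-base and
every continuous map `f : B → X`, some nonempty open subset of `B` has finite image.
The universe of `B` is independent of that of `X`. -/
def IsBPiScattered (X : Type u) [TopologicalSpace X] : Prop :=
  ∀ (B : Type v) [TopologicalSpace B] [BaireSpace B] [Nonempty B],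
    (∃ P : Set (Set B), P.Countable ∧ IsPiBase P) →
      ∀ f : B → X, Continuous f →
        ∃ U : Set B, IsOpen U ∧ U.Nonempty ∧ (f '' U).Finite

/-- A space is scattered if every nonempty subspace has an isolated point. -/
def IsScatteredSpace (Y : Type u) [TopologicalSpace Y] : Prop :=
  ∀ S : Set Y, S.Nonempty → ∃ x : S, IsOpen ({x} : Set S)

/-- `X` is `k`-scattered: every compact Hausdorff subspace of `X` is scattered. -/
def IsKScattered (X : Type u) [TopologicalSpace X] : Prop :=
  ∀ K : Set X, IsCompact K → T2Space K → IsScatteredSpace K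

/-! Suppose every nonempty open subset of `B` has infinite image under `f`, and let `V i` enumerate
a π-base. Let `U` consist of the `g` that, for some `n`, exceed 1 at `e n` and somewhere on each `f
'' V i` with `i ≤ n`. Finite sets miss some `e n` and a point of each `f '' V i`, so `0` lies in the
closure of `U`. Along a sequence in `U` tending to `0` the indices `n` tend to infinity, so Baire
category gives a point `b` at which the values at `f b` exceed 1 infinitely often, a contradiction.

A compact set that is not scattered yields a compact perfect `C`. The graph of a Cantor scheme in
`C` is compact, injects into `X` and maps onto the Cantor space. On a closed subset where that map
is irreducible, preimages of a countable base form a π-base, while no nonempty open set is finite.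
-/

/-- In a completely regular space a finite set and a finite set disjoint from it can be separated
by a continuous real-valued function. -/
theorem exists_continuous_eq_zero_one_lt_of_finite {X : Type u} [TopologicalSpace X] [T35Space X]
    {A D : Set X} (hA : A.Finite) (hD : D.Finite) (hAD : Disjoint A D) :
    ∃ g : X → ℝ, Continuous g ∧ (∀ x ∈ A, g x = 0) ∧ ∀ x ∈ D, 1 < g x := by
  have hsep : ∀ y ∈ D, ∃ f : X → ℝ, Continuous f ∧ (∀ x, 0 ≤ f x) ∧ f y = 2 ∧
      ∀ x ∈ A, f x = 0 := by
    intro y hy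
    obtain ⟨f, hfc, hfy, hfA⟩ := CompletelyRegularSpace.completely_regular y A hA.isClosed
      (hAD.notMem_of_mem_right hy)
    -- The peak value 2 leaves room above 1, and nonnegativity keeps the other summands from
    -- lowering the sum below.
    refine ⟨fun x => 2 * (1 - (f x : ℝ)), by fun_prop, fun x => ?_, by simp [hfy], fun x hx => ?_⟩
    · have := (f x).2.2
      linarith
    · simp [hfA hx]
  choose! f hfc hf0 hfy hfA using hsep
  refine ⟨fun x => ∑ y ∈ hD.toFinset, f y x,
    continuous_finsetSum _ fun y hy => hfc y (by simpa using hy),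
    fun x hx => Finset.sum_eq_zero fun y hy => hfA y (by simpa using hy) x hx, fun x hx => ?_⟩
  have h := Finset.single_le_sum (f := fun y => f y x) (s := hD.toFinset)
    (fun y hy => hf0 y (by simpa using hy) x) (by simpa using hx)
  simp only [hfy x hx] at h
  linarith

theorem Cp.continuous_apply {X : Type u} [TopologicalSpace X] (x : X) :
    Continuous fun g : Cp X => g.1 x :=
  (_root_.continuous_apply x).comp continuous_subtype_val

/-- A neighbourhood of `g` in `C_p(X)` contains all functions that agree with `g` on some finite
set. -/
theorem Cp.exists_finite_of_mem_nhds {X : Type u} [TopologicalSpace X] {g : Cp X}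
    {W : Set (Cp X)} (hW : W ∈ 𝓝 g) :
    ∃ A : Set X, A.Finite ∧ ∀ h : Cp X, (∀ x ∈ A, h.1 x = g.1 x) → h ∈ W := by
  rw [nhds_subtype_eq_comap, mem_comap] at hW
  obtain ⟨T, hT, hTW⟩ := hW
  rw [nhds_pi, Filter.mem_pi] at hT
  obtain ⟨A, hA, t, ht, htT⟩ := hT
  refine ⟨A, hA, fun h hh => hTW (htT fun x hx => ?_)⟩
  rw [hh x hx]
  exact mem_of_mem_nhds (ht x)

/-- A nonempty space with a countable `π`-base has a `π`-base enumerated by `ℕ`. -/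
theorem IsPiBase.exists_nat_enumeration {B : Type v} [TopologicalSpace B] [Nonempty B]
    {P : Set (Set B)} (hPc : P.Countable) (hP : IsPiBase P) :
    ∃ V : ℕ → Set B, (∀ n, IsOpen (V n) ∧ (V n).Nonempty) ∧
      ∀ U : Set B, IsOpen U → U.Nonempty → ∃ n, V n ⊆ U := by
  obtain ⟨V₀, hV₀, -⟩ := hP.2 univ isOpen_univ univ_nonempty
  obtain ⟨V, rfl⟩ := hPc.exists_eq_range ⟨V₀, hV₀⟩
  refine ⟨V, fun n => hP.1 _ (mem_range_self n), fun U hU hne => ?_⟩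
  obtain ⟨_, ⟨n, rfl⟩, hn⟩ := hP.2 U hU hne
  exact ⟨n, hn⟩

theorem IsKappaFrechetUrysohn.isBPiScattered {X : Type u} [TopologicalSpace X] [T35Space X]
    (hX : IsKappaFrechetUrysohn (Cp X)) : IsBPiScattered.{u, v} X := by
  intro B _ _ _ ⟨P, hPc, hP⟩ f hf
  by_contra! hinf
  obtain ⟨V, hV, hVU⟩ := hP.exists_nat_enumeration hPc
  have : Infinite X := Set.infinite_univ_iff.1
    ((hinf univ isOpen_univ univ_nonempty).mono (subset_univ _))
  let e : ℕ ↪ X := Infinite.natEmbedding X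
  -- The condition at `e n` is a clock: pointwise convergence to `0` rules out each fixed `n`
  -- eventually.
  let U : Set (Cp X) := ⋃ n, {g | 1 < g.1 (e n)} ∩ ⋂ i ∈ Iic n, ⋃ b ∈ V i, {g | 1 < g.1 (f b)}
  have hUo : IsOpen U := by
    refine isOpen_iUnion fun n => (isOpen_lt continuous_const (Cp.continuous_apply _)).inter ?_
    exact (finite_Iic n).isOpen_biInter fun i _ => isOpen_biUnion fun b _ =>
      isOpen_lt continuous_const (Cp.continuous_apply _)
  have hmem : ∀ g : Cp X, g ∈ U ↔ ∃ n, 1 < g.1 (e n) ∧ ∀ i ≤ n, ∃ b ∈ V i, 1 < g.1 (f b) := by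
    intro g
    simp [U]
  let z : Cp X := ⟨fun _ => 0, continuous_const⟩
  have hz : z ∈ closure U := by
    rw [mem_closure_iff_nhds]
    intro W hW
    obtain ⟨A, hA, hAW⟩ := Cp.exists_finite_of_mem_nhds hW
    obtain ⟨n, hn⟩ : ∃ n, e n ∉ A := by
      by_contra! h
      exact infinite_range_of_injective e.injective (hA.subset (range_subset_iff.2 h))
    have hb : ∀ i, ∃ b ∈ V i, f b ∉ A := by
      intro i
      obtain ⟨_, ⟨b, hb, rfl⟩, hbA⟩ := (hinf (V i) (hV i).1 (hV i).2).exists_notMem_finite hA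
      exact ⟨b, hb, hbA⟩
    choose b hbV hbA using hb
    obtain ⟨g, hgc, hgA, hgD⟩ := exists_continuous_eq_zero_one_lt_of_finite
      (D := insert (e n) ((fun i => f (b i)) '' Iic n)) hA
      (((finite_Iic n).image _).insert _) (by
        rw [Set.disjoint_right]
        rintro _ (rfl | ⟨i, -, rfl⟩)
        exacts [hn, hbA i])
    refine ⟨⟨g, hgc⟩, hAW _ hgA, (hmem _).2 ⟨n, hgD _ (mem_insert _ _), fun i hi => ?_⟩⟩
    exact ⟨b i, hbV i, hgD _ (mem_insert_of_mem _ (mem_image_of_mem _ hi))⟩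
  obtain ⟨a, haU, ha⟩ := hX U hUo z hz
  have hlim : ∀ x, ∀ᶠ k in atTop, (a k).1 x < 1 := fun x =>
    ((Cp.continuous_apply x).tendsto z |>.comp ha).eventually_lt_const one_pos
  choose N hN1 hN2 using fun k => (hmem _).1 (haU k)
  have hNk : ∀ i, ∀ᶠ k in atTop, i ≤ N k := by
    intro i
    have : ∀ᶠ k in atTop, ∀ j ∈ Iio i, (a k).1 (e j) < 1 :=
      (eventually_all_finite (finite_Iio i)).2 fun j _ => hlim (e j)
    filter_upwards [this] with k hk
    by_contra! hlt
    exact (hN1 k).not_gt (hk _ hlt)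
  -- A point in every `O m` has `1 < (a k).1 (f b)` for infinitely many `k`. Density holds because
  -- `a k` exceeds 1 somewhere on `f '' V i` once `i ≤ N k`.
  let O : ℕ → Set B := fun m => ⋃ k ≥ m, {b | 1 < (a k).1 (f b)}
  have hOo : ∀ m, IsOpen (O m) := fun m => isOpen_biUnion fun k _ =>
    isOpen_lt continuous_const ((a k).2.comp hf)
  have hOd : ∀ m, Dense (O m) := by
    intro m
    rw [dense_iff_inter_open]
    intro W hW hne
    obtain ⟨i, hi⟩ := hVU W hW hne
    obtain ⟨k, hik, hmk⟩ := ((hNk i).and (eventually_ge_atTop m)).exists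
    obtain ⟨b, hb, hgt⟩ := hN2 k i hik
    exact ⟨b, hi hb, mem_biUnion (t := fun k => {b | 1 < (a k).1 (f b)}) hmk hgt⟩
  obtain ⟨b, hb⟩ := (dense_iInter_of_isOpen_nat hOo hOd).nonempty
  obtain ⟨m, hm⟩ := eventually_atTop.1 (hlim (f b))
  obtain ⟨k, hmk, hk⟩ := mem_iUnion₂.1 (mem_iInter.1 hb m)
  exact lt_asymm (hm k hmk) hk

/-- A nonempty perfect set in a `T₂.₅` space contains a disjoint Cantor scheme of nonempty closed
sets. -/
theorem Perfect.exists_cantorScheme {X : Type u} [TopologicalSpace X] [T25Space X] {C : Set X}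
    (hC : Perfect C) (hne : C.Nonempty) :
    ∃ D : List Bool → Set X, CantorScheme.Antitone D ∧ CantorScheme.Disjoint D ∧ D [] = C ∧
      ∀ l, IsClosed (D l) ∧ (D l).Nonempty := by
  choose C0 C1 h0 h1 hdisj using
    fun E : {E : Set X // Perfect E ∧ E.Nonempty} => E.2.1.splitting E.2.2
  let D : List Bool → {E : Set X // Perfect E ∧ E.Nonempty} := fun l =>
    l.rec ⟨C, hC, hne⟩ fun a _ E =>
      bif a then ⟨C1 E, (h1 E).1, (h1 E).2.1⟩ else ⟨C0 E, (h0 E).1, (h0 E).2.1⟩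
  refine ⟨fun l => (D l).1, ?_, ?_, rfl, fun l => ⟨(D l).2.1.closed, (D l).2.2⟩⟩
  · rintro l (_ | _)
    exacts [(h0 (D l)).2.2, (h1 (D l)).2.2]
  · rintro l (_ | _) (_ | _) hab
    exacts [absurd rfl hab, hdisj (D l), (hdisj (D l)).symm, absurd rfl hab]

open PiNat in
/-- The graph of a Cantor scheme of closed sets is closed. -/
theorem isClosed_setOf_forall_mem_res {X : Type u} [TopologicalSpace X] {D : List Bool → Set X}
    (hD : ∀ l, IsClosed (D l)) :
    IsClosed {p : X × (ℕ → Bool) | ∀ n, p.1 ∈ D (res p.2 n)} := by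
  rw [ofPred_forall]
  refine isClosed_iInter fun n => ?_
  rw [← isOpen_compl_iff, isOpen_iff_mem_nhds]
  rintro ⟨x, σ⟩ hx
  have h1 : (D (res σ n))ᶜ ∈ 𝓝 x := (hD _).isOpen_compl.mem_nhds hx
  have h2 : cylinder σ n ∈ 𝓝 σ := (isOpen_cylinder _ σ n).mem_nhds (self_mem_cylinder σ n)
  filter_upwards [prod_mem_nhds h1 h2] with p hp
  have h3 := hp.2
  rw [cylinder_eq_res] at h3
  change p.1 ∉ D (res p.2 n)
  rw [show res p.2 n = res σ n from h3]
  exact hp.1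

/-- An irreducible continuous map from a compact space onto a Hausdorff space: every nonempty open
set contains the preimage of a nonempty open set. -/
theorem exists_isOpen_preimage_subset_of_irreducible {M A : Type*} [TopologicalSpace M]
    [CompactSpace M] [TopologicalSpace A] [T2Space A] {q : M → A} (hq : Continuous q)
    (hirr : ∀ E : Set M, E ≠ univ → IsClosed E → q '' E ≠ univ) {U : Set M} (hU : IsOpen U)
    (hne : U.Nonempty) : ∃ W : Set A, IsOpen W ∧ W.Nonempty ∧ q ⁻¹' W ⊆ U := by
  refine ⟨(q '' Uᶜ)ᶜ, (hU.isClosed_compl.isCompact.image hq).isClosed.isOpen_compl, ?_, ?_⟩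
  · rw [nonempty_compl]
    exact hirr _ (by simpa using hne.ne_empty) hU.isClosed_compl
  · intro x hx
    by_contra hxU
    exact hx (mem_image_of_mem q hxU)

/-- If every compact set admits no nonempty perfect subset, the space is `k`-scattered. -/
theorem isKScattered_of_forall_perfect {X : Type u} [TopologicalSpace X] [T2Space X]
    (h : ∀ C : Set X, IsCompact C → Perfect C → ¬ C.Nonempty) : IsKScattered X := by
  intro K hK _ S hS
  by_contra! hiso
  have hpre : Preperfect ((↑) '' S : Set X) := by
    rw [preperfect_iff_nhds]
    rintro _ ⟨x, hx, rfl⟩ W hW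
    by_contra! hW'
    refine hiso ⟨x, hx⟩ ?_
    rw [isOpen_singleton_iff_nhds_eq_pure]
    refine le_antisymm (le_pure_iff.2 ?_) (pure_le_nhds _)
    have hc : Continuous fun s : S => ((s : K) : X) :=
      continuous_subtype_val.comp continuous_subtype_val
    filter_upwards [hc.continuousAt.preimage_mem_nhds (x := ⟨x, hx⟩) hW] with s hs
    exact Subtype.ext (Subtype.ext (hW' _ ⟨hs, mem_image_of_mem _ s.2⟩))
  -- Passing to the closure makes the set closed, hence perfect, and keeps it compact.
  refine h _ (hK.closure_of_subset ?_) hpre.perfect_closure (hS.image _).closure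
  exact (image_subset_range _ _).trans Subtype.range_coe.subset

open PiNat in
/-- A nonempty open subset of the Cantor space is infinite. -/
theorem infinite_of_isOpen_natBool {W : Set (ℕ → Bool)} (hW : IsOpen W) (hne : W.Nonempty) :
    W.Infinite := by
  obtain ⟨σ, hσ⟩ := hne
  obtain ⟨_, ⟨τ, n, rfl⟩, hmem, hsub⟩ :=
    (isTopologicalBasis_cylinders fun _ : ℕ => Bool).exists_subset_of_mem_open hσ hW
  -- Flipping a single coordinate at or beyond `n` stays in the cylinder of length `n`, and
  -- different coordinates give different points.
  refine infinite_of_injective_forall_mem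
    (f := fun k : ℕ => Function.update σ (n + k) (!σ (n + k))) (fun j k hjk => ?_)
    fun k => hsub fun i hi => ?_
  · by_contra hne
    have h := congrFun hjk (n + j)
    simp [Function.update_of_ne (show n + j ≠ n + k by omega)] at h
  · rw [Function.update_of_ne (by omega)]
    exact hmem i hi

open PiNat in
theorem IsBPiScattered.isKScattered {X : Type u} [TopologicalSpace X] [T35Space X]
    (hX : IsBPiScattered.{u, u} X) : IsKScattered X := by
  refine isKScattered_of_forall_perfect fun C hCc hC hne => ?_
  obtain ⟨D, hanti, hdisj, hD0, hD⟩ := hC.exists_cantorScheme hne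
  -- Each branch has a point in all its sets by compactness, and each point lies on at most one
  -- branch by disjointness.
  let G : Set (X × (ℕ → Bool)) := {p | ∀ n, p.1 ∈ D (res p.2 n)}
  have hGc : IsCompact G :=
    (hCc.prod isCompact_univ).of_isClosed_subset (isClosed_setOf_forall_mem_res fun l => (hD l).1)
      fun p hp => ⟨by simpa [hD0] using hp 0, mem_univ _⟩
  have : CompactSpace G := isCompact_iff_compactSpace.1 hGc
  have hsub : ∀ l, D l ⊆ C := by
    intro l
    induction l with
    | nil => exact hD0.subset
    | cons a l ih => exact (hanti l a).trans ih
  let π : G → ULift.{u} (ℕ → Bool) := fun p => ⟨p.1.2⟩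
  have hπ : Continuous π := by fun_prop
  have hπs : π.Surjective := by
    rintro ⟨σ⟩
    obtain ⟨x, hx⟩ := IsCompact.nonempty_iInter_of_sequence_nonempty_isCompact_isClosed
      (fun n => D (res σ n)) (fun n => hanti _ _) (fun n => (hD _).2)
      (hCc.of_isClosed_subset (hD _).1 (hsub _)) fun n => (hD _).1
    exact ⟨⟨(x, σ), mem_iInter.1 hx⟩, rfl⟩
  have hinj : Function.Injective fun p : G => p.1.1 := by
    rintro ⟨⟨x, σ⟩, hx⟩ ⟨⟨y, τ⟩, hy⟩ (rfl : x = y)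
    have hres : ∀ n, res σ n = res τ n := by
      intro n
      induction n with
      | zero => rfl
      | succ n ih =>
        rw [res_succ, res_succ, ih]
        congr 1
        -- `res` puts the newest bit at the head, so the two lists share a tail and differ in the
        -- head: their sets are disjoint siblings.
        by_contra hne'
        have h1 : x ∈ D (res σ (n + 1)) := hx (n + 1)
        have h2 : x ∈ D (res τ (n + 1)) := hy (n + 1)
        rw [res_succ, ih] at h1
        exact (hdisj _ hne').notMem_of_mem_left h1 h2
    have : σ = τ := res_injective (funext hres)
    subst this
    rfl
  -- Irreducibility is what gives `E` a countable π-base, although `G` itself need not have one.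
  obtain ⟨E, _, hEs, hirr⟩ := exists_compact_surjective_zorn_subset hπ hπs
  let q : E → ULift.{u} (ℕ → Bool) := E.domRestrict π
  have hq : Continuous q := hπ.comp continuous_subtype_val
  have hqs : q.Surjective := by
    intro σ
    obtain ⟨p, hp, rfl⟩ := hEs.symm.subset (mem_univ σ)
    exact ⟨⟨p, hp⟩, rfl⟩
  have : Nonempty E := (hqs ⟨fun _ => false⟩).nonempty
  have : SecondCountableTopology (ULift.{u} (ℕ → Bool)) :=
    Homeomorph.ulift.isEmbedding.secondCountableTopology
  let b := TopologicalSpace.countableBasis (ULift.{u} (ℕ → Bool))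
  obtain ⟨U, hU, hUne, hUfin⟩ := hX E ⟨(fun W => q ⁻¹' W) '' b,
    (TopologicalSpace.countable_countableBasis _).image _, by
      rintro _ ⟨W, hW, rfl⟩
      exact ⟨(TopologicalSpace.isOpen_of_mem_countableBasis hW).preimage hq,
        (TopologicalSpace.nonempty_of_mem_countableBasis hW).preimage hqs⟩, by
      intro U hU hUne
      obtain ⟨W, hW, ⟨σ, hσ⟩, hWU⟩ := exists_isOpen_preimage_subset_of_irreducible hq hirr hU hUne
      obtain ⟨W', hW', -, hsub'⟩ :=
        (TopologicalSpace.isBasis_countableBasis _).exists_subset_of_mem_open hσ hW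
      exact ⟨_, mem_image_of_mem _ hW', (preimage_mono hsub').trans hWU⟩⟩
    (fun p => p.1.1.1) (by fun_prop)
  -- By injectivity into `X` the set `U` is finite, so the open set `W` of the Cantor space would be
  -- finite as well.
  obtain ⟨W, hW, ⟨σ, hσ⟩, hWU⟩ := exists_isOpen_preimage_subset_of_irreducible hq hirr hU hUne
  have hWfin : W.Finite := by
    have := (hUfin.of_finite_image (hinj.comp Subtype.val_injective).injOn).subset hWU
    simpa [image_preimage_eq _ hqs] using this.image q
  have hW' : IsOpen (ULift.up ⁻¹' W : Set (ℕ → Bool)) := hW.preimage continuous_uliftUp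
  exact infinite_of_isOpen_natBool hW' ⟨σ.down, hσ⟩
    (hWfin.preimage ULift.up_injective.injOn)

theorem mainTheorem5 (X : Type u) [TopologicalSpace X] [T35Space X] :
    (IsKappaFrechetUrysohn (Cp X) → IsBPiScattered.{u, v} X ∧ IsKScattered X) ∧
      (IsBPiScattered.{u, u} X → IsKScattered X) :=
  ⟨fun h => ⟨h.isBPiScattered, IsBPiScattered.isKScattered h.isBPiScattered⟩,
    IsBPiScattered.isKScattered⟩
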